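/- Let $\mathcal H,\mathcal H_1,\dots,\mathcal H_n$ be finite-dimensional complex Hilbert spaces, $N=\{1,\dots,n\}$, and $\mathcal H_X=\bigotimes_{i\in X}\mathcal H_i$ for $X\subseteq N$. Write $\mathcal S(\mathcal J)$ for the set of density operators and $\mathcal S_1(\mathcal J)$ for the set of pure states on a Hilbert space $\mathcal J$; a quantum operation is a completely positive trace-preserving linear map. A quantum operation $\mathcal E:\mathcal S(\mathcal J)\to\mathcal S(\mathcal K)$ is called reversible if there is a quantum operation $\mathcal R:\mathcal S(\mathcal K)\to\mathcal S(\mathcal J)$ with $\mathcal R(\mathcal E(\rho))=\rho$ for all $\rho\in\mathcal S(\mathcal J)$, and vanishing if there is $\rho_0\in\mathcal S(\mathcal K)$ with $\mathcal E(\rho)=\rho_0$ for all $\rho\in\mathcal S(\mathcal J)$. A quantum secret sharing (QSS) scheme is a reversible quantum operation $W_N:\mathcal S(\mathcal H)\to\mathcal S(\mathcal H_N)$. For $X\subseteq N$ put $W_X=\operatorname{Tr}_{N\setminus X}\circ W_N$ and $W_i=W_{\{i\}}$; the set $X$ is called qualified if $W_X$ is reversible, and forbidden if $W_X$ is vanishing.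 For integers $k\ge 0$ and $L\ge 1$, the scheme $W_N$ is a $(k,L,n)$-threshold ramp QSS scheme if, for every $X\subseteq N$, $X$ is forbidden iff $|X|\le k-L$, and $X$ is qualified iff $|X|\ge k$. Theorem. Let $W_N$ be a $(k,L,n)$-threshold ramp QSS scheme, and let $\mu$ be a Borel probability measure on $\mathcal S_1(\mathcal H)$ with $\mu(O)>0$ for every nonempty relatively open set $O\subseteq\mathcal S_1(\mathcal H)$. Let $\sigma_\mu=\int\rho\,\mu(d\rho)$, and let $H(\rho)=-\operatorname{Tr}\rho\log\rho$ denote the von Neumann entropy. Then $$\frac1L\,H(\sigma_\mu)\le\frac1n\sum_{i=1}^n H\bigl(W_i(\sigma_\mu)\bigr).$$ -/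

import Mathlib

open scoped ComplexOrder

noncomputable section

namespace QSS

/-! The finite-dimensional Hilbert space with orthonormal basis indexed by a finite type `a`
is `ℂ^a`, and its linear operators are the matrices `Matrix a a ℂ`. -/

section Operations

variable {a b : Type*} [Fintype a] [Fintype b]

/-- Density operators: positive semidefinite operators of trace one. -/
def densityOperators (a : Type*) [Fintype a] : Set (Matrix a a ℂ) :=
  {ρ | ρ.PosSemidef ∧ ρ.trace = 1}

/-- Pure states: the projections `|ψ⟩⟨ψ|` onto unit vectors `ψ`. -/
def pureStates (a : Type*) [Fintype a] : Set (Matrix a a ℂ) :=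
  {ρ | ∃ ψ : a → ℂ, star ψ ⬝ᵥ ψ = 1 ∧ ρ = Matrix.vecMulVec ψ (star ψ)}

/-- The set of pure states carries the Borel σ-algebra of its relative topology. -/
instance : MeasurableSpace (pureStates a) := borel _

instance : BorelSpace (pureStates a) := ⟨rfl⟩

/-- The operator `(id_m ⊗ E)(M)`: the map `E` is applied to each of the `m × m` blocks of `M`. -/
def ampliation (E : Matrix a a ℂ →ₗ[ℂ] Matrix b b ℂ) (m : ℕ)
    (M : Matrix (Fin m × a) (Fin m × a) ℂ) : Matrix (Fin m × b) (Fin m × b) ℂ :=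
  Matrix.of fun p q => E (Matrix.of fun i j => M (p.1, i) (q.1, j)) p.2 q.2

/-- Quantum operations: completely positive and trace preserving linear maps. -/
structure IsQuantumOperation (E : Matrix a a ℂ →ₗ[ℂ] Matrix b b ℂ) : Prop where
  completelyPositive : ∀ (m : ℕ) (M : Matrix (Fin m × a) (Fin m × a) ℂ),
    M.PosSemidef → (ampliation E m M).PosSemidef
  tracePreserving : ∀ A : Matrix a a ℂ, (E A).trace = A.trace

/-- `E` is reversible with respect to a set `S` of states: some quantum operation `R`
recovers every state of `S`. -/
def Reversible (E : Matrix a a ℂ →ₗ[ℂ] Matrix b b ℂ) (S : Set (Matrix a a ℂ)) : Prop :=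
  ∃ R : Matrix b b ℂ →ₗ[ℂ] Matrix a a ℂ, IsQuantumOperation R ∧ ∀ ρ ∈ S, R (E ρ) = ρ

/-- `E` is vanishing with respect to a set `S` of states: it sends all states of `S`
to one and the same state. -/
def Vanishing (E : Matrix a a ℂ →ₗ[ℂ] Matrix b b ℂ) (S : Set (Matrix a a ℂ)) : Prop :=
  ∃ ρ₀ ∈ densityOperators b, ∀ ρ ∈ S, E ρ = ρ₀

/-- Von Neumann entropy `H(ρ) = -Tr ρ log ρ`, with the logarithm taken by functional calculus
(and `0 log 0 = 0`, since `Real.log 0 = 0`). -/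
def entropy [DecidableEq a] (ρ : Matrix a a ℂ) : ℝ :=
  -((ρ * cfc Real.log ρ).trace).re

/-- The average state `σ_μ = ∫ ρ μ(dρ)` of an ensemble of pure states, entry by entry. -/
def averageState (μ : MeasureTheory.Measure (pureStates a)) : Matrix a a ℂ :=
  Matrix.of fun i j => ∫ ρ : pureStates a, (ρ : Matrix a a ℂ) i j ∂μ

end Operations

section Schemes

variable {a : Type*} [Fintype a] {n : ℕ} {d : Fin n → Type*} [∀ i, Fintype (d i)]

/-- Index set of the product basis of `H_X = ⨂_{i ∈ X} H_i`, where `H_i = ℂ^(d i)`. -/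
abbrev ShareIndex (d : Fin n → Type*) (X : Finset (Fin n)) : Type _ :=
  ∀ i : {i // i ∈ X}, d i

/-- The partial trace `Tr_{N \ X}` from operators on `H_N` to operators on `H_X`. -/
def partialTrace (d : Fin n → Type*) [∀ i, Fintype (d i)] (X : Finset (Fin n)) :
    Matrix (∀ i, d i) (∀ i, d i) ℂ →ₗ[ℂ] Matrix (ShareIndex d X) (ShareIndex d X) ℂ where
  toFun A := Matrix.of fun x y => ∑ z : (∀ i : {i // i ∉ X}, d i),
    A ((Equiv.piEquivPiSubtypeProd (· ∈ X) d).symm (x, z))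
      ((Equiv.piEquivPiSubtypeProd (· ∈ X) d).symm (y, z))
  map_add' A B := by
    ext x y
    simp [Finset.sum_add_distrib]
  map_smul' c A := by
    ext x y
    simp [Finset.mul_sum]

/-- `W_X = Tr_{N \ X} ∘ W_N`. -/
def marginal (W : Matrix a a ℂ →ₗ[ℂ] Matrix (∀ i, d i) (∀ i, d i) ℂ) (X : Finset (Fin n)) :
    Matrix a a ℂ →ₗ[ℂ] Matrix (ShareIndex d X) (ShareIndex d X) ℂ :=
  partialTrace d X ∘ₗ W

/-- A quantum secret sharing scheme: a quantum operation `W_N` that is reversible with respect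
to all states. -/
structure IsScheme (W : Matrix a a ℂ →ₗ[ℂ] Matrix (∀ i, d i) (∀ i, d i) ℂ) : Prop where
  isQuantumOperation : IsQuantumOperation W
  reversible : Reversible W (densityOperators a)

/-- `X` is qualified if `W_X` is reversible with respect to all states. -/
def Qualified (W : Matrix a a ℂ →ₗ[ℂ] Matrix (∀ i, d i) (∀ i, d i) ℂ)
    (X : Finset (Fin n)) : Prop :=
  Reversible (marginal W X) (densityOperators a)

/-- `X` is forbidden if `W_X` is vanishing with respect to all states. -/
def Forbidden (W : Matrix a a ℂ →ₗ[ℂ] Matrix (∀ i, d i) (∀ i, d i) ℂ)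
    (X : Finset (Fin n)) : Prop :=
  Vanishing (marginal W X) (densityOperators a)

/-- `(k, L, n)`-threshold ramp quantum secret sharing schemes. -/
structure IsRampScheme (k L : ℕ)
    (W : Matrix a a ℂ →ₗ[ℂ] Matrix (∀ i, d i) (∀ i, d i) ℂ) : Prop extends IsScheme W where
  forbidden_iff : ∀ X : Finset (Fin n), Forbidden W X ↔ (X.card : ℤ) ≤ (k : ℤ) - (L : ℤ)
  qualified_iff : ∀ X : Finset (Fin n), Qualified W X ↔ k ≤ X.card

end Schemes

end QSS

end

/-!
A quantum operation is an isometry into its output system and an environment, after which the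
environment is discarded. It is reversible exactly when the complementary operation, which keeps the
environment instead, is constant (Knill–Laflamme), and then the output state for `σ` has entropy
`H(σ)` plus the entropy of the environment.

Let `X` be a forbidden set of `k - L` shares and `Y` a disjoint set of `L` shares, so that `X ∪ Y`
is qualified, and let `E` be the environment of `X ∪ Y`. Reversibility of `W_{X ∪ Y}` gives
`H(XY) = H(σ) + H(E)`. The operation into `Y` and `E` has environment `X`, where nothing depends on
the secret, hence `H(YE) = H(σ) + H(X)`. Adding the subadditivity inequalities
`H(XY) ≤ H(X) + H(Y)` and `H(YE) ≤ H(Y) + H(E)` yields `H(σ) ≤ H(Y) ≤ ∑_{i ∈ Y} H(i)`, and it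
remains to average over the sets `Y` with `L` elements.
-/

noncomputable section

namespace QSS

open Matrix Real
open scoped Kronecker

/-! ### Von Neumann entropy -/

section Entropy

variable {a b : Type*} [DecidableEq a] [DecidableEq b]

lemma isHermitian_diagonal_ofReal (p : a → ℝ) : (diagonal fun i => (p i : ℂ)).IsHermitian :=
  isHermitian_diagonal_iff.2 fun i => Complex.conj_ofReal (p i)

variable [Fintype a] [Fintype b]

lemma entropy_eq_sum_eigenvalues {ρ : Matrix a a ℂ} (h : ρ.IsHermitian) :
    entropy ρ = ∑ i, negMulLog (h.eigenvalues i) := by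
  have hlog : ρ * cfc Real.log ρ = Unitary.conjStarAlgAut ℂ _ h.eigenvectorUnitary
      (diagonal fun i => ((h.eigenvalues i * Real.log (h.eigenvalues i) : ℝ) : ℂ)) := by
    rw [h.cfc_eq, IsHermitian.cfc]
    nth_rw 1 [h.spectral_theorem]
    rw [← map_mul, diagonal_mul_diagonal]
    congr 2
    ext i
    simp
  rw [entropy, hlog, Unitary.conjStarAlgAut_apply, trace_mul_cycle]
  simp [trace_diagonal, negMulLog, ← Finset.sum_neg_distrib]

lemma entropy_eq_sum_roots {ρ : Matrix a a ℂ} (h : ρ.IsHermitian) :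
    entropy ρ = (ρ.charpoly.roots.map fun z => negMulLog z.re).sum := by
  rw [entropy_eq_sum_eigenvalues h, h.roots_charpoly_eq_eigenvalues, Multiset.map_map]
  rfl

lemma entropy_eq_of_charpoly_eq {ρ σ : Matrix a a ℂ} (hρ : ρ.IsHermitian) (hσ : σ.IsHermitian)
    (h : ρ.charpoly = σ.charpoly) : entropy ρ = entropy σ := by
  rw [entropy_eq_sum_roots hρ, entropy_eq_sum_roots hσ, h]

lemma entropy_diagonal (p : a → ℝ) :
    entropy (diagonal fun i => (p i : ℂ)) = ∑ i, negMulLog (p i) := by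
  have hroots : (diagonal fun i => (p i : ℂ)).charpoly.roots =
      Finset.univ.val.map fun i => (p i : ℂ) := by
    rw [charpoly_diagonal, ← Polynomial.roots_multiset_prod_X_sub_C (Finset.univ.val.map _),
      Multiset.map_map]
    rfl
  rw [entropy_eq_sum_roots (isHermitian_diagonal_ofReal p), hroots, Multiset.map_map]
  rfl

lemma entropy_transpose {ρ : Matrix a a ℂ} (hρ : ρ.IsHermitian) : entropy ρᵀ = entropy ρ :=
  entropy_eq_of_charpoly_eq hρ.transpose hρ ρ.charpoly_transpose

lemma entropy_reindex (e : a ≃ b) {ρ : Matrix a a ℂ} (hρ : ρ.IsHermitian) :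
    entropy (reindex e e ρ) = entropy ρ := by
  have hreindex : (reindex e e ρ).IsHermitian := hρ.submatrix e.symm
  rw [entropy_eq_sum_roots hρ, entropy_eq_sum_roots hreindex, charpoly_reindex]

lemma entropy_unitary_conj {U ρ : Matrix a a ℂ} (hU : U ∈ unitaryGroup a ℂ) (hρ : ρ.IsHermitian) :
    entropy (U * ρ * Uᴴ) = entropy ρ := by
  refine entropy_eq_of_charpoly_eq (isHermitian_mul_mul_conjTranspose U hρ) hρ ?_
  rw [charpoly_mul_comm, ← mul_assoc, ← star_eq_conjTranspose, Unitary.star_mul_self_of_mem hU,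
    one_mul]

lemma exists_unitary_conj_eq_diagonal {ρ : Matrix a a ℂ} (h : ρ.IsHermitian) :
    ∃ U ∈ unitaryGroup a ℂ, U * ρ * Uᴴ = diagonal fun i => (h.eigenvalues i : ℂ) := by
  refine ⟨_, Unitary.star_mem h.eigenvectorUnitary.2, ?_⟩
  rw [← star_eq_conjTranspose, star_star]
  exact (Unitary.conjStarAlgAut_star_apply _ _).symm.trans h.conjStarAlgAut_star_eigenvectorUnitary

lemma entropy_mul_conjTranspose_self (M : Matrix a b ℂ) :
    entropy (M * Mᴴ) = entropy (Mᴴ * M) := by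
  have hroots := congrArg Polynomial.roots (charpoly_mul_comm' M Mᴴ)
  rw [Polynomial.roots_mul ((Polynomial.monic_X_pow _).mul (charpoly_monic _)).ne_zero,
    Polynomial.roots_mul ((Polynomial.monic_X_pow _).mul (charpoly_monic _)).ne_zero] at hroots
  rw [entropy_eq_sum_roots (isHermitian_mul_conjTranspose_self M),
    entropy_eq_sum_roots (isHermitian_conjTranspose_mul_self M)]
  -- The extra roots are all zero, where `negMulLog` vanishes.
  simpa [Multiset.map_nsmul, Multiset.sum_nsmul] using
    congrArg (fun s : Multiset ℂ => (s.map fun z => negMulLog z.re).sum) hroots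

lemma entropy_kronecker {σ : Matrix a a ℂ} {τ : Matrix b b ℂ} (hσ : σ.IsHermitian)
    (hτ : τ.IsHermitian) :
    entropy (σ ⊗ₖ τ) = τ.trace.re * entropy σ + σ.trace.re * entropy τ := by
  obtain ⟨U, hU, hUσ⟩ := exists_unitary_conj_eq_diagonal hσ
  obtain ⟨V, hV, hVτ⟩ := exists_unitary_conj_eq_diagonal hτ
  have hστ : (σ ⊗ₖ τ).IsHermitian := by rw [IsHermitian, conjTranspose_kronecker, hσ.eq, hτ.eq]
  have hdiag : (U ⊗ₖ V) * (σ ⊗ₖ τ) * (U ⊗ₖ V)ᴴ =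
      diagonal fun i : a × b => ((hσ.eigenvalues i.1 * hτ.eigenvalues i.2 : ℝ) : ℂ) := by
    simp only [conjTranspose_kronecker, ← mul_kronecker_mul, hUσ, hVτ,
      diagonal_kronecker_diagonal, Complex.ofReal_mul]
  rw [← entropy_unitary_conj (kronecker_mem_unitary hU hV) hστ, hdiag, entropy_diagonal,
    entropy_eq_sum_eigenvalues hσ, entropy_eq_sum_eigenvalues hτ,
    hσ.trace_eq_sum_eigenvalues, hτ.trace_eq_sum_eigenvalues]
  simp [Fintype.sum_prod_type, negMulLog_mul, Finset.sum_add_distrib, ← Finset.mul_sum,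
    ← Finset.sum_mul]

lemma normSq_mem_doublyStochastic {U : Matrix a a ℂ} (hU : U ∈ unitaryGroup a ℂ) :
    (of fun i j => ‖U i j‖ ^ 2) ∈ doublyStochastic ℝ a := by
  refine mem_doublyStochastic_iff_sum.2 ⟨fun i j => sq_nonneg ‖U i j‖, fun i => ?_, fun j => ?_⟩
  · have h := congr_fun₂ (mem_unitaryGroup_iff.1 hU) i i
    simp only [mul_apply, star_apply, one_apply_eq, RCLike.star_def, Complex.mul_conj'] at h
    exact_mod_cast h
  · have h := congr_fun₂ (mem_unitaryGroup_iff'.1 hU) j j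
    simp only [mul_apply, star_apply, one_apply_eq, RCLike.star_def, Complex.conj_mul'] at h
    exact_mod_cast h

lemma sum_le_sum_mulVec_of_concaveOn {s : Set ℝ} {f : ℝ → ℝ} (hf : ConcaveOn ℝ s f)
    {D : Matrix a a ℝ} (hD : D ∈ doublyStochastic ℝ a) {x : a → ℝ} (hx : ∀ j, x j ∈ s) :
    ∑ j, f (x j) ≤ ∑ i, f ((D *ᵥ x) i) :=
  calc ∑ j, f (x j) = ∑ j, (∑ i, D i j) * f (x j) := by
        simp only [sum_col_of_mem_doublyStochastic hD, one_mul]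
    _ = ∑ i, ∑ j, D i j * f (x j) := by
        simp only [Finset.sum_mul]
        exact Finset.sum_comm
    _ ≤ ∑ i, f ((D *ᵥ x) i) := Finset.sum_le_sum fun i _ =>
        hf.le_map_sum (fun j _ => nonneg_of_mem_doublyStochastic hD)
          (sum_row_of_mem_doublyStochastic hD i) fun j _ => hx j

lemma entropy_le_sum_negMulLog_diag {ρ : Matrix a a ℂ} (h : ρ.PosSemidef) :
    entropy ρ ≤ ∑ i, negMulLog (ρ i i).re := by
  set U := (h.1.eigenvectorUnitary : Matrix a a ℂ)
  have hdiag (i : a) : (ρ i i).re = ((of fun i j => ‖U i j‖ ^ 2) *ᵥ h.1.eigenvalues) i := by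
    have hρ : ρ i i = ((∑ j, ‖U i j‖ ^ 2 * h.1.eigenvalues j : ℝ) : ℂ) := by
      conv_lhs => rw [h.1.spectral_theorem, Unitary.conjStarAlgAut_apply, mul_apply]
      push_cast
      refine Finset.sum_congr rfl fun j _ => ?_
      rw [mul_diagonal, star_apply, ← Complex.mul_conj', mul_right_comm]
      rfl
    rw [hρ, Complex.ofReal_re]
    rfl
  simpa only [entropy_eq_sum_eigenvalues h.1, hdiag] using
    sum_le_sum_mulVec_of_concaveOn concaveOn_negMulLog
      (normSq_mem_doublyStochastic h.1.eigenvectorUnitary.2) h.eigenvalues_nonneg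

end Entropy

section Shannon

lemma negMulLog_le_sub_sub_mul_log {q s : ℝ} (hq : 0 ≤ q) (hs : 0 ≤ s) (h : s = 0 → q = 0) :
    negMulLog q ≤ s - q - q * log s := by
  rcases hs.eq_or_lt with rfl | hs
  · simp [h rfl]
  · have hqs : s * (q / s) = q := mul_div_cancel₀ q hs.ne'
    calc negMulLog q = negMulLog (s * (q / s)) := by rw [hqs]
      _ = s * negMulLog (q / s) - s * (q / s) * log s := by
        rw [negMulLog_mul, negMulLog]
        ring
      _ ≤ s * (1 - q / s) - s * (q / s) * log s := by
        gcongr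
        exact negMulLog_le_one_sub_self (by positivity)
      _ = s - q - q * log s := by rw [mul_sub, mul_one, hqs]

lemma sum_negMulLog_le_neg_sum_mul_log {ι : Type*} [Fintype ι] {q s : ι → ℝ} (hq : ∀ i, 0 ≤ q i)
    (hs : ∀ i, 0 ≤ s i) (hsq : ∀ i, s i = 0 → q i = 0) (h : ∑ i, s i ≤ ∑ i, q i) :
    ∑ i, negMulLog (q i) ≤ -∑ i, q i * log (s i) :=
  calc ∑ i, negMulLog (q i) ≤ ∑ i, (s i - q i - q i * log (s i)) :=
        Finset.sum_le_sum fun i _ => negMulLog_le_sub_sub_mul_log (hq i) (hs i) (hsq i)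
    _ ≤ -∑ i, q i * log (s i) := by
        simp only [Finset.sum_sub_distrib]
        linarith

lemma sum_negMulLog_le_add {a b : Type*} [Fintype a] [Fintype b] {q : a → b → ℝ}
    (hq : ∀ i j, 0 ≤ q i j) (h1 : ∑ i, ∑ j, q i j = 1) :
    ∑ i, ∑ j, negMulLog (q i j) ≤
      ∑ i, negMulLog (∑ j, q i j) + ∑ j, negMulLog (∑ i, q i j) := by
  set p : a → ℝ := fun i => ∑ j, q i j
  set r : b → ℝ := fun j => ∑ i, q i j
  have hp0 : ∀ i, p i = 0 → ∀ j, q i j = 0 := fun i hi j =>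
    (Finset.sum_eq_zero_iff_of_nonneg fun j _ => hq i j).1 hi j (Finset.mem_univ j)
  have hr0 : ∀ j, r j = 0 → ∀ i, q i j = 0 := fun j hj i =>
    (Finset.sum_eq_zero_iff_of_nonneg fun i _ => hq i j).1 hj i (Finset.mem_univ i)
  have hr1 : ∑ j, r j = 1 := Finset.sum_comm.trans h1
  have hsum : ∑ x : a × b, p x.1 * r x.2 = ∑ x : a × b, q x.1 x.2 := by
    rw [Fintype.sum_prod_type, Fintype.sum_prod_type, ← Fintype.sum_mul_sum, hr1, mul_one]
  have hlog : ∀ i j, q i j * log (p i * r j) = q i j * log (p i) + q i j * log (r j) := by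
    intro i j
    by_cases hqij : q i j = 0
    · simp [hqij]
    · rw [log_mul (fun h => hqij (hp0 i h j)) (fun h => hqij (hr0 j h i)), mul_add]
  have hgibbs : ∑ x : a × b, negMulLog (q x.1 x.2) ≤
      -∑ x : a × b, q x.1 x.2 * log (p x.1 * r x.2) :=
    sum_negMulLog_le_neg_sum_mul_log (fun x => hq x.1 x.2)
      (fun x => mul_nonneg (Finset.sum_nonneg fun j _ => hq x.1 j)
        (Finset.sum_nonneg fun i _ => hq i x.2))
      (fun x hx => (mul_eq_zero.1 hx).elim (fun h => hp0 _ h _) (fun h => hr0 _ h _)) hsum.le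
  calc ∑ i, ∑ j, negMulLog (q i j) ≤ -∑ i, ∑ j, q i j * log (p i * r j) := by
        rwa [Fintype.sum_prod_type, Fintype.sum_prod_type] at hgibbs
    _ = -(∑ i, p i * log (p i) + ∑ j, r j * log (r j)) := by
        simp only [hlog, Finset.sum_add_distrib, ← Finset.sum_mul]
        rw [Finset.sum_comm (f := fun i j => q i j * log (r j))]
        simp only [p, r, Finset.sum_mul]
    _ = ∑ i, negMulLog (p i) + ∑ j, negMulLog (r j) := by
        simp only [negMulLog, neg_mul, Finset.sum_neg_distrib, neg_add]

end Shannon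

/-! ### Partial traces and subadditivity -/

section BipartiteSystem

variable {a b : Type*}

/-- The partial trace over the second factor of a bipartite system. -/
def traceRight [Fintype b] : Matrix (a × b) (a × b) ℂ →ₗ[ℂ] Matrix a a ℂ where
  toFun ρ := of fun x x' => ∑ y, ρ (x, y) (x', y)
  map_add' ρ σ := by
    ext x x'
    simp [Finset.sum_add_distrib]
  map_smul' c ρ := by
    ext x x'
    simp [Finset.mul_sum]

/-- The partial trace over the first factor of a bipartite system. -/
def traceLeft [Fintype a] : Matrix (a × b) (a × b) ℂ →ₗ[ℂ] Matrix b b ℂ where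
  toFun ρ := of fun y y' => ∑ x, ρ (x, y) (x, y')
  map_add' ρ σ := by
    ext y y'
    simp [Finset.sum_add_distrib]
  map_smul' c ρ := by
    ext y y'
    simp [Finset.mul_sum]

lemma traceRight_apply [Fintype b] (ρ : Matrix (a × b) (a × b) ℂ) (x x' : a) :
    traceRight ρ x x' = ∑ y, ρ (x, y) (x', y) := rfl

lemma traceLeft_apply [Fintype a] (ρ : Matrix (a × b) (a × b) ℂ) (y y' : b) :
    traceLeft ρ y y' = ∑ x, ρ (x, y) (x, y') := rfl

lemma posSemidef_traceRight [Fintype b] {ρ : Matrix (a × b) (a × b) ℂ} (h : ρ.PosSemidef) :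
    (traceRight ρ).PosSemidef := by
  have hsum : traceRight ρ = ∑ y, ρ.submatrix (·, y) (·, y) := by
    ext x x'
    simp only [traceRight_apply, Matrix.sum_apply, submatrix_apply]
  rw [hsum]
  exact posSemidef_sum _ fun y _ => h.submatrix _

lemma posSemidef_traceLeft [Fintype a] {ρ : Matrix (a × b) (a × b) ℂ} (h : ρ.PosSemidef) :
    (traceLeft ρ).PosSemidef :=
  posSemidef_traceRight (h.submatrix Prod.swap)

variable [Fintype a] [Fintype b]

lemma trace_traceRight (ρ : Matrix (a × b) (a × b) ℂ) : (traceRight ρ).trace = ρ.trace :=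
  (Fintype.sum_prod_type fun i => ρ i i).symm

lemma trace_traceRight_mul [DecidableEq b] (ρ : Matrix (a × b) (a × b) ℂ) (B : Matrix a a ℂ) :
    (traceRight ρ * B).trace = (ρ * (B ⊗ₖ (1 : Matrix b b ℂ))).trace := by
  simp only [trace, diag_apply, mul_apply, traceRight_apply, Fintype.sum_prod_type,
    kroneckerMap_apply, one_apply, mul_ite, mul_one, mul_zero,
    Finset.sum_ite_eq', Finset.mem_univ, if_true, Finset.sum_mul]
  exact Finset.sum_congr rfl fun x _ => Finset.sum_comm

lemma trace_traceLeft_mul [DecidableEq a] (ρ : Matrix (a × b) (a × b) ℂ) (B : Matrix b b ℂ) :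
    (traceLeft ρ * B).trace = (ρ * ((1 : Matrix a a ℂ) ⊗ₖ B)).trace := by
  simp only [trace, diag_apply, mul_apply, traceLeft_apply, Fintype.sum_prod_type_right,
    kroneckerMap_apply, one_apply, ite_mul, one_mul, zero_mul, mul_ite, mul_zero,
    Finset.sum_ite_eq', Finset.mem_univ, if_true, Finset.sum_mul]
  exact Finset.sum_congr rfl fun y _ => Finset.sum_comm

lemma traceRight_kronecker_conj [DecidableEq b] (U : Matrix a a ℂ) {V : Matrix b b ℂ}
    (hV : V ∈ unitaryGroup b ℂ) (ρ : Matrix (a × b) (a × b) ℂ) :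
    traceRight ((U ⊗ₖ V) * ρ * (U ⊗ₖ V)ᴴ) = U * traceRight ρ * Uᴴ := by
  refine ext_iff_trace_mul_right.2 fun B => ?_
  have hV' : Vᴴ * V = 1 := Unitary.star_mul_self_of_mem hV
  calc (traceRight ((U ⊗ₖ V) * ρ * (U ⊗ₖ V)ᴴ) * B).trace
      = (ρ * ((U ⊗ₖ V)ᴴ * (B ⊗ₖ 1) * (U ⊗ₖ V))).trace := by
        rw [trace_traceRight_mul, mul_assoc, mul_assoc, trace_mul_comm]
        simp only [mul_assoc]
    _ = (ρ * ((Uᴴ * B * U) ⊗ₖ 1)).trace := by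
        rw [conjTranspose_kronecker, ← mul_kronecker_mul, ← mul_kronecker_mul, mul_one, hV']
    _ = (U * traceRight ρ * Uᴴ * B).trace := by
        rw [← trace_traceRight_mul, mul_assoc U, mul_assoc U, trace_mul_comm U]
        simp only [mul_assoc]

lemma traceLeft_kronecker_conj [DecidableEq a] {U : Matrix a a ℂ} (hU : U ∈ unitaryGroup a ℂ)
    (V : Matrix b b ℂ) (ρ : Matrix (a × b) (a × b) ℂ) :
    traceLeft ((U ⊗ₖ V) * ρ * (U ⊗ₖ V)ᴴ) = V * traceLeft ρ * Vᴴ := by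
  refine ext_iff_trace_mul_right.2 fun B => ?_
  have hU' : Uᴴ * U = 1 := Unitary.star_mul_self_of_mem hU
  calc (traceLeft ((U ⊗ₖ V) * ρ * (U ⊗ₖ V)ᴴ) * B).trace
      = (ρ * ((U ⊗ₖ V)ᴴ * (1 ⊗ₖ B) * (U ⊗ₖ V))).trace := by
        rw [trace_traceLeft_mul, mul_assoc, mul_assoc, trace_mul_comm]
        simp only [mul_assoc]
    _ = (ρ * (1 ⊗ₖ (Vᴴ * B * V))).trace := by
        rw [conjTranspose_kronecker, ← mul_kronecker_mul, ← mul_kronecker_mul, mul_one, hU']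
    _ = (V * traceLeft ρ * Vᴴ * B).trace := by
        rw [← trace_traceLeft_mul, mul_assoc V, mul_assoc V, trace_mul_comm V]
        simp only [mul_assoc]

variable [DecidableEq a] [DecidableEq b]

lemma entropy_le_sum_negMulLog_diag_add {ρ : Matrix (a × b) (a × b) ℂ}
    (h : ρ ∈ densityOperators (a × b)) :
    entropy ρ ≤ ∑ i, negMulLog (traceRight ρ i i).re + ∑ j, negMulLog (traceLeft ρ j j).re := by
  have hnonneg (i : a) (j : b) : 0 ≤ (ρ (i, j) (i, j)).re :=
    (Complex.nonneg_iff.1 h.1.diag_nonneg).1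
  have htotal : ∑ i, ∑ j, (ρ (i, j) (i, j)).re = 1 := by
    have := congrArg Complex.re h.2
    simpa [trace, Fintype.sum_prod_type] using this
  calc entropy ρ ≤ ∑ i, ∑ j, negMulLog (ρ (i, j) (i, j)).re := by
        simpa only [Fintype.sum_prod_type] using entropy_le_sum_negMulLog_diag h.1
    _ ≤ ∑ i, negMulLog (traceRight ρ i i).re + ∑ j, negMulLog (traceLeft ρ j j).re := by
        simpa only [traceRight_apply, traceLeft_apply, Complex.re_sum] using
          sum_negMulLog_le_add hnonneg htotal

theorem entropy_le_add {ρ : Matrix (a × b) (a × b) ℂ} (h : ρ ∈ densityOperators (a × b)) :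
    entropy ρ ≤ entropy (traceRight ρ) + entropy (traceLeft ρ) := by
  have hR := (posSemidef_traceRight h.1).1
  have hL := (posSemidef_traceLeft h.1).1
  obtain ⟨U, hU, hUR⟩ := exists_unitary_conj_eq_diagonal hR
  obtain ⟨V, hV, hVL⟩ := exists_unitary_conj_eq_diagonal hL
  -- Conjugating by `U ⊗ₖ V` diagonalizes both marginals at once.
  have hT : U ⊗ₖ V ∈ unitaryGroup (a × b) ℂ := kronecker_mem_unitary hU hV
  set ρ' := (U ⊗ₖ V) * ρ * (U ⊗ₖ V)ᴴ
  have hρ' : ρ' ∈ densityOperators (a × b) := by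
    refine ⟨h.1.mul_mul_conjTranspose_same _, ?_⟩
    rw [trace_mul_cycle, ← star_eq_conjTranspose, Unitary.star_mul_self_of_mem hT, one_mul, h.2]
  rw [← entropy_unitary_conj hT h.1.1, entropy_eq_sum_eigenvalues hR, entropy_eq_sum_eigenvalues hL]
  simpa only [ρ', traceRight_kronecker_conj U hV, traceLeft_kronecker_conj hU V, hUR, hVL,
    diagonal_apply_eq, Complex.ofReal_re] using entropy_le_sum_negMulLog_diag_add hρ'

end BipartiteSystem

/-! ### Density operators and quantum operations -/

section DensityOperators

variable {a b : Type*} [Fintype a] [Fintype b]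

open scoped MatrixOrder Matrix.Norms.L2Operator in
lemma exists_eq_mul_conjTranspose_self {ρ : Matrix a a ℂ} (h : ρ.PosSemidef) :
    ∃ S : Matrix a a ℂ, ρ = S * Sᴴ := by
  classical
  exact CStarAlgebra.nonneg_iff_eq_mul_star_self.1 h.nonneg

open scoped MatrixOrder Matrix.Norms.L2Operator in
lemma span_densityOperators : Submodule.span ℂ (densityOperators a) = ⊤ := by
  classical
  rw [eq_top_iff, ← CStarAlgebra.span_nonneg (A := Matrix a a ℂ), Submodule.span_le]
  intro A hA
  have hpsd : A.PosSemidef := nonneg_iff_posSemidef.1 hA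
  by_cases htr : A.trace = 0
  · rw [hpsd.trace_eq_zero_iff.1 htr]
    exact Submodule.zero_mem _
  · have hmem : A.trace⁻¹ • A ∈ densityOperators a :=
      ⟨hpsd.smul (inv_nonneg.2 hpsd.trace_nonneg), by
        rw [trace_smul, smul_eq_mul, inv_mul_cancel₀ htr]⟩
    rw [← smul_inv_smul₀ htr A]
    exact Submodule.smul_mem _ _ (Submodule.subset_span hmem)

lemma linearMap_ext_densityOperators {M : Type*} [AddCommMonoid M] [Module ℂ M]
    {F G : Matrix a a ℂ →ₗ[ℂ] M} (h : ∀ ρ ∈ densityOperators a, F ρ = G ρ) : F = G :=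
  LinearMap.ext_on span_densityOperators h

lemma eq_of_trace_mul_eq {A B : Matrix a a ℂ}
    (h : ∀ ρ ∈ densityOperators a, (A * ρ).trace = (B * ρ).trace) : A = B := by
  have htrace : traceLinearMap a ℂ ℂ ∘ₗ LinearMap.mulLeft ℂ A =
      traceLinearMap a ℂ ℂ ∘ₗ LinearMap.mulLeft ℂ B := linearMap_ext_densityOperators h
  exact ext_iff_trace_mul_right.2 fun C => LinearMap.congr_fun htrace C

lemma IsQuantumOperation.map_mem_densityOperators {E : Matrix a a ℂ →ₗ[ℂ] Matrix b b ℂ}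
    (hE : IsQuantumOperation E) {ρ : Matrix a a ℂ} (hρ : ρ ∈ densityOperators a) :
    E ρ ∈ densityOperators b :=
  ⟨(hE.completelyPositive 1 (ρ.submatrix Prod.snd Prod.snd)
      (hρ.1.submatrix _)).submatrix (Prod.mk 0),
    (hE.tracePreserving ρ).trans hρ.2⟩

end DensityOperators

section Kraus

variable {a b e : Type*}

/-- The completely positive map with Kraus operators `K`. -/
def krausMap [Fintype a] [Fintype e] (K : e → Matrix b a ℂ) :
    Matrix a a ℂ →ₗ[ℂ] Matrix b b ℂ where
  toFun A := ∑ z, K z * A * (K z)ᴴ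
  map_add' A B := by simp [Matrix.mul_add, Matrix.add_mul, Finset.sum_add_distrib]
  map_smul' c A := by simp [Finset.smul_sum]

/-- The Kraus operators of the complementary channel of `krausMap K`, which maps a state to the
state of the environment `e` after the Stinespring isometry given by `K`. -/
def complementaryKraus (K : e → Matrix b a ℂ) : b → Matrix e a ℂ :=
  fun s => of fun z i => K z s i

section

variable [Fintype a] [Fintype e]

lemma krausMap_apply (K : e → Matrix b a ℂ) (A : Matrix a a ℂ) :
    krausMap K A = ∑ z, K z * A * (K z)ᴴ := rfl

lemma krausMap_apply_apply (K : e → Matrix b a ℂ) (A : Matrix a a ℂ) (s t : b) :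
    krausMap K A s t = ∑ z, (K z * A * (K z)ᴴ) s t := Matrix.sum_apply _ _ _ _

lemma posSemidef_krausMap [Finite b] (K : e → Matrix b a ℂ) {ρ : Matrix a a ℂ} (hρ : ρ.PosSemidef) :
    (krausMap K ρ).PosSemidef :=
  posSemidef_sum _ fun z _ => hρ.mul_mul_conjTranspose_same (K z)

lemma krausMap_single [DecidableEq a] (K : e → Matrix b a ℂ) (i j : a) (s t : b) :
    krausMap K (single i j 1) s t = (K · s i) ⬝ᵥ star (K · t j) := by
  simp [krausMap_apply_apply, dotProduct, mul_apply, single_apply, ite_and]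

lemma krausMap_comp [Fintype b] {c f : Type*} [Fintype f] (T : f → Matrix c b ℂ)
    (K : e → Matrix b a ℂ) :
    krausMap T ∘ₗ krausMap K = krausMap fun p : f × e => T p.1 * K p.2 := by
  refine LinearMap.ext fun A => ?_
  simp only [LinearMap.comp_apply, krausMap_apply, Matrix.mul_sum, Matrix.sum_mul,
    conjTranspose_mul, Matrix.mul_assoc, Fintype.sum_prod_type]

end

section

variable [Fintype a] [Fintype b]

lemma krausMap_complementaryKraus_apply (K : e → Matrix b a ℂ) (A : Matrix a a ℂ) (z w : e) :
    krausMap (complementaryKraus K) A z w = (K z * A * (K w)ᴴ).trace :=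
  krausMap_apply_apply _ _ _ _

lemma trace_krausMap_complementaryKraus [Fintype e] (K : e → Matrix b a ℂ) (A : Matrix a a ℂ) :
    (krausMap (complementaryKraus K) A).trace = (krausMap K A).trace := by
  simp only [trace, diag_apply, krausMap_apply_apply]
  exact Finset.sum_comm

lemma krausMap_complementaryKraus_eq_iff [DecidableEq a] {K : e → Matrix b a ℂ}
    {τ : Matrix e e ℂ} :
    (∀ ρ ∈ densityOperators a, krausMap (complementaryKraus K) ρ = τ) ↔
      ∀ z w, (K w)ᴴ * K z = τ z w • 1 := by
  have htrace {z w : e} {ρ : Matrix a a ℂ} :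
      krausMap (complementaryKraus K) ρ z w = ((K w)ᴴ * K z * ρ).trace := by
    rw [krausMap_complementaryKraus_apply, trace_mul_cycle]
  constructor
  · refine fun h z w => eq_of_trace_mul_eq fun ρ hρ => ?_
    rw [← htrace, h ρ hρ, smul_mul, one_mul, trace_smul, hρ.2, smul_eq_mul, mul_one]
  · refine fun h ρ hρ => Matrix.ext fun z w => ?_
    rw [htrace, h, smul_mul, one_mul, trace_smul, hρ.2, smul_eq_mul, mul_one]

end

variable [Fintype a] [Fintype b] [Fintype e]

-- A factorization of the Choi matrix of `E` has the Kraus operators as its columns.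
lemma IsQuantumOperation.exists_krausMap_eq {E : Matrix a a ℂ →ₗ[ℂ] Matrix b b ℂ}
    (hE : IsQuantumOperation E) :
    ∃ K : Fin (Fintype.card a) × b → Matrix b a ℂ, krausMap K = E := by
  classical
  let f := Fintype.equivFin a
  let v : Fin (Fintype.card a) × a → ℂ := fun p => if f p.2 = p.1 then 1 else 0
  obtain ⟨S, hS⟩ := exists_eq_mul_conjTranspose_self
    (hE.completelyPositive _ _ (posSemidef_vecMulVec_self_star v))
  have hblock (i j : a) : (of fun i' j' => vecMulVec v (star v) (f i, i') (f j, j')) =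
      single i j (1 : ℂ) := by
    ext i' j'
    simp [v, single_apply, vecMulVec_apply, eq_comm, ← ite_and, and_comm]
  refine ⟨fun z => of fun s i => S (f i, s) z, ext_linearMap _ fun i j => ?_⟩
  ext s t
  have hchoi := congr_fun₂ hS (f i, s) (f j, t)
  simp only [ampliation, of_apply, hblock] at hchoi
  simp [krausMap_single, dotProduct, hchoi, mul_apply]

lemma exists_eq_smul_one_of_krausMap_eq_id [DecidableEq a] {K : e → Matrix a a ℂ}
    (h : krausMap K = LinearMap.id) : ∃ c : e → ℂ, ∀ z, K z = c z • 1 := by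
  rcases isEmpty_or_nonempty a with ha | ⟨⟨i₀⟩⟩
  · exact ⟨0, fun z => Subsingleton.elim _ _⟩
  have hinner (i j s t : a) : (K · s i) ⬝ᵥ star (K · t j) = single i j (1 : ℂ) s t := by
    rw [← krausMap_single, h, LinearMap.id_apply]
  have hoff {s i : a} (hsi : s ≠ i) : (K · s i) = 0 := by
    rw [← dotProduct_self_star_eq_zero, hinner]
    simp [hsi.symm]
  have hdiag (s : a) : (K · s s) = (K · i₀ i₀) := by
    rw [← sub_eq_zero, ← dotProduct_self_star_eq_zero]
    simp [star_sub, sub_dotProduct, dotProduct_sub, hinner]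
  refine ⟨fun z => K z i₀ i₀, fun z => ?_⟩
  ext s i
  rcases eq_or_ne s i with rfl | hsi
  · simpa using congr_fun (hdiag s) z
  · simpa [hsi] using congr_fun (hoff hsi) z

lemma sum_conjTranspose_mul_self_eq_one [DecidableEq a] {K : e → Matrix b a ℂ}
    (h : ∀ A, (krausMap K A).trace = A.trace) : ∑ z, (K z)ᴴ * K z = 1 := by
  refine eq_of_trace_mul_eq fun ρ _ => ?_
  rw [one_mul, ← h ρ, krausMap_apply, trace_sum, Matrix.sum_mul, trace_sum]
  exact Finset.sum_congr rfl fun z _ => by rw [trace_mul_cycle (K z) ρ]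

lemma Reversible.vanishing_complementaryKraus {K : e → Matrix b a ℂ}
    (h : Reversible (krausMap K) (densityOperators a)) (hne : (densityOperators a).Nonempty) :
    Vanishing (krausMap (complementaryKraus K)) (densityOperators a) := by
  classical
  obtain ⟨R, hR, hRK⟩ := h
  obtain ⟨T, rfl⟩ := hR.exists_krausMap_eq
  have hid : krausMap (fun p : (Fin (Fintype.card b) × a) × e => T p.1 * K p.2) =
      LinearMap.id := by
    rw [← krausMap_comp]
    exact linearMap_ext_densityOperators hRK
  obtain ⟨l, hl⟩ := exists_eq_smul_one_of_krausMap_eq_id hid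
  have hscalar (z w : e) : (K w)ᴴ * K z = (∑ t, star (l (t, w)) * l (t, z)) • 1 :=
    calc (K w)ᴴ * K z = (K w)ᴴ * (∑ t, (T t)ᴴ * T t) * K z := by
          rw [sum_conjTranspose_mul_self_eq_one hR.tracePreserving, Matrix.mul_one]
      _ = ∑ t, (T t * K w)ᴴ * (T t * K z) := by
          simp only [Matrix.mul_sum, Matrix.sum_mul, conjTranspose_mul, Matrix.mul_assoc]
      _ = (∑ t, star (l (t, w)) * l (t, z)) • 1 := by
          simp only [fun t z => hl (t, z), conjTranspose_smul, conjTranspose_one,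
            smul_mul_smul_comm, mul_one, Finset.sum_smul]
  have hconst := krausMap_complementaryKraus_eq_iff.2 hscalar
  obtain ⟨σ, hσ⟩ := hne
  refine ⟨_, ?_, hconst⟩
  rw [← hconst σ hσ]
  refine ⟨posSemidef_krausMap _ hσ.1, ?_⟩
  rw [trace_krausMap_complementaryKraus, ← hR.tracePreserving, hRK σ hσ, hσ.2]

lemma entropy_krausMap_of_conjTranspose_mul_eq_smul [DecidableEq a] [DecidableEq b]
    [DecidableEq e] {K : e → Matrix b a ℂ} {τ : Matrix e e ℂ} (hτ : τ ∈ densityOperators e)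
    (h : ∀ z w, (K w)ᴴ * K z = τ z w • 1) {σ : Matrix a a ℂ} (hσ : σ ∈ densityOperators a) :
    entropy (krausMap K σ) = entropy σ + entropy τ := by
  obtain ⟨S, rfl⟩ := exists_eq_mul_conjTranspose_self hσ.1
  let M : Matrix b (a × e) ℂ := of fun s p => (K p.2 * S) s p.1
  have hout : krausMap K (S * Sᴴ) = M * Mᴴ := by
    ext s t
    simp only [krausMap_apply_apply, ← Matrix.mul_assoc]
    simp only [Matrix.mul_assoc _ Sᴴ, ← conjTranspose_mul]
    exact (Fintype.sum_prod_type_right fun p => M s p * star (M t p)).symm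
  have hgram : Mᴴ * M = (Sᴴ * S) ⊗ₖ τᵀ := by
    ext ⟨x, z⟩ ⟨x', w⟩
    have hzw : (K z * S)ᴴ * (K w * S) = τ w z • (Sᴴ * S) := by
      rw [conjTranspose_mul, Matrix.mul_assoc, ← Matrix.mul_assoc (K z)ᴴ, h, Matrix.smul_mul,
        Matrix.one_mul, Matrix.mul_smul]
    rw [kroneckerMap_apply, transpose_apply, mul_comm]
    exact congr_fun₂ hzw x x'
  have htr : (Sᴴ * S).trace = 1 := (trace_mul_comm _ _).trans hσ.2
  rw [hout, entropy_mul_conjTranspose_self, hgram,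
    entropy_kronecker (isHermitian_conjTranspose_mul_self S) hτ.1.1.transpose, trace_transpose,
    htr, hτ.2, entropy_transpose hτ.1.1, entropy_mul_conjTranspose_self]
  simp

lemma Vanishing.entropy_krausMap [DecidableEq a] [DecidableEq b] [DecidableEq e]
    {K : e → Matrix b a ℂ}
    (h : Vanishing (krausMap (complementaryKraus K)) (densityOperators a)) {σ : Matrix a a ℂ}
    (hσ : σ ∈ densityOperators a) :
    entropy (krausMap K σ) = entropy σ + entropy (krausMap (complementaryKraus K) σ) := by
  obtain ⟨τ, hτ, hconst⟩ := h
  rw [hconst σ hσ]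
  exact entropy_krausMap_of_conjTranspose_mul_eq_smul hτ
    (krausMap_complementaryKraus_eq_iff.1 hconst) hσ

end Kraus

section Exchange

variable {a x y e : Type*}

/-- The Kraus operators of the operation that keeps the subsystem `y` and the environment `e` of
`krausMap K` and discards the subsystem `x` instead. -/
def exchangeKraus (K : e → Matrix (x × y) a ℂ) : x → Matrix (y × e) a ℂ :=
  fun u => of fun p i => K p.2 (u, p.1) i

variable [Fintype a]

lemma traceLeft_krausMap_exchangeKraus [Fintype x] [Fintype y] (K : e → Matrix (x × y) a ℂ)
    (ρ : Matrix a a ℂ) :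
    traceLeft (krausMap (exchangeKraus K) ρ) = krausMap (complementaryKraus K) ρ := by
  ext z w
  rw [krausMap_apply_apply, Fintype.sum_prod_type_right]
  simp only [traceLeft_apply, krausMap_apply_apply]
  rfl

lemma traceRight_krausMap_exchangeKraus [Fintype x] [Fintype e] (K : e → Matrix (x × y) a ℂ)
    (ρ : Matrix a a ℂ) :
    traceRight (krausMap (exchangeKraus K) ρ) = traceLeft (krausMap K ρ) := by
  ext v v'
  simp only [traceRight_apply, traceLeft_apply, krausMap_apply_apply]
  exact Finset.sum_comm

lemma krausMap_complementaryKraus_exchangeKraus [Fintype y] [Fintype e]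
    (K : e → Matrix (x × y) a ℂ) :
    krausMap (complementaryKraus (exchangeKraus K)) = traceRight ∘ₗ krausMap K := by
  refine LinearMap.ext fun ρ => Matrix.ext fun u u' => ?_
  rw [krausMap_apply_apply, Fintype.sum_prod_type]
  simp only [LinearMap.comp_apply, traceRight_apply, krausMap_apply_apply]
  rfl

theorem entropy_le_of_reversible_of_vanishing [Fintype x] [Fintype y] [Fintype e] [DecidableEq a]
    [DecidableEq y] {K : e → Matrix (x × y) a ℂ}
    (hrev : Reversible (krausMap K) (densityOperators a))
    (hvan : Vanishing (traceRight ∘ₗ krausMap K) (densityOperators a)) {σ : Matrix a a ℂ}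
    (hσ : σ ∈ densityOperators a) : entropy σ ≤ entropy (traceLeft (krausMap K σ)) := by
  classical
  have htr : (traceRight (krausMap K σ)).trace = 1 := by
    obtain ⟨τ, hτ, hconst⟩ := hvan
    exact (congrArg trace (hconst σ hσ)).trans hτ.2
  have hxy : krausMap K σ ∈ densityOperators (x × y) :=
    ⟨posSemidef_krausMap K hσ.1, by rwa [← trace_traceRight]⟩
  have hye : krausMap (exchangeKraus K) σ ∈ densityOperators (y × e) :=
    ⟨posSemidef_krausMap _ hσ.1, by
      rwa [← trace_krausMap_complementaryKraus, krausMap_complementaryKraus_exchangeKraus]⟩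
  rw [← krausMap_complementaryKraus_exchangeKraus] at hvan
  have hK := (hrev.vanishing_complementaryKraus ⟨σ, hσ⟩).entropy_krausMap hσ
  have hE := hvan.entropy_krausMap hσ
  have hsubK := entropy_le_add hxy
  have hsubE := entropy_le_add hye
  rw [krausMap_complementaryKraus_exchangeKraus, LinearMap.comp_apply] at hE
  rw [traceRight_krausMap_exchangeKraus, traceLeft_krausMap_exchangeKraus] at hsubE
  linarith

end Exchange

section AverageState

open MeasureTheory

section Integral

variable {a Ω : Type*} [MeasurableSpace Ω] {μ : Measure Ω} {ρ : Ω → Matrix a a ℂ}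

lemma posSemidef_of_integral [Finite a] (hint : ∀ i j, Integrable (fun ω => ρ ω i j) μ)
    (hρ : ∀ ω, (ρ ω).PosSemidef) : (of fun i j => ∫ ω, ρ ω i j ∂μ).PosSemidef := by
  have := Fintype.ofFinite a
  refine .of_dotProduct_mulVec_nonneg ?_ fun v => ?_
  · ext i j
    rw [conjTranspose_apply, of_apply, of_apply, RCLike.star_def, ← integral_conj]
    exact integral_congr_ae (.of_forall fun ω => (hρ ω).1.apply i j)
  · have hquad : star v ⬝ᵥ (of fun i j => ∫ ω, ρ ω i j ∂μ) *ᵥ v =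
        ∫ ω, star v ⬝ᵥ ρ ω *ᵥ v ∂μ := by
      simp only [dotProduct, mulVec, of_apply]
      rw [integral_finsetSum _ fun i _ =>
        (integrable_finsetSum _ fun j _ => (hint i j).mul_const _).const_mul _]
      refine Finset.sum_congr rfl fun i _ => ?_
      rw [integral_const_mul, integral_finsetSum _ fun j _ => (hint i j).mul_const _]
      simp only [integral_mul_const]
    rw [hquad]
    exact integral_nonneg fun ω => (hρ ω).dotProduct_mulVec_nonneg v

lemma trace_of_integral [Fintype a] (hint : ∀ i, Integrable (fun ω => ρ ω i i) μ) :
    (of fun i j => ∫ ω, ρ ω i j ∂μ).trace = ∫ ω, (ρ ω).trace ∂μ :=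
  (integral_finsetSum _ fun i _ => hint i).symm

end Integral

variable {a : Type*} [Fintype a]

lemma norm_le_one_of_mem_pureStates {ρ : Matrix a a ℂ} (hρ : ρ ∈ pureStates a) (i j : a) :
    ‖ρ i j‖ ≤ 1 := by
  obtain ⟨ψ, hψ, rfl⟩ := hρ
  have hsum : ∑ i, ‖ψ i‖ ^ 2 = 1 := by
    simp only [dotProduct, Pi.star_apply, RCLike.star_def, Complex.conj_mul'] at hψ
    exact_mod_cast hψ
  have hle (i : a) : ‖ψ i‖ ≤ 1 := by
    rw [← sq_le_one_iff₀ (norm_nonneg _), ← hsum]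
    exact Finset.single_le_sum (f := fun i => ‖ψ i‖ ^ 2) (fun _ _ => sq_nonneg _)
      (Finset.mem_univ i)
  rw [vecMulVec_apply, norm_mul, Pi.star_apply, norm_star]
  exact mul_le_one₀ (hle i) (norm_nonneg _) (hle j)

lemma mem_densityOperators_of_mem_pureStates {ρ : Matrix a a ℂ} (hρ : ρ ∈ pureStates a) :
    ρ ∈ densityOperators a := by
  obtain ⟨ψ, hψ, rfl⟩ := hρ
  exact ⟨posSemidef_vecMulVec_self_star ψ, by rw [trace_vecMulVec, dotProduct_comm, hψ]⟩

lemma integrable_pureStates_apply (μ : Measure (pureStates a)) [IsFiniteMeasure μ] (i j : a) :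
    Integrable (fun ρ : pureStates a => (ρ : Matrix a a ℂ) i j) μ :=
  .of_bound (continuous_subtype_val.matrix_elem i j).aestronglyMeasurable 1
    (.of_forall fun ρ => norm_le_one_of_mem_pureStates ρ.2 i j)

lemma averageState_mem_densityOperators (μ : Measure (pureStates a)) [IsProbabilityMeasure μ] :
    averageState μ ∈ densityOperators a := by
  have hint := integrable_pureStates_apply μ
  have hmem (ρ : pureStates a) := mem_densityOperators_of_mem_pureStates ρ.2
  refine ⟨posSemidef_of_integral hint fun ρ => (hmem ρ).1, ?_⟩
  rw [averageState, trace_of_integral fun i => hint i i]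
  simp only [(hmem _).2, integral_const, probReal_univ, one_smul]

end AverageState

/-! ### Shares of a secret sharing scheme -/

section Shares

variable {n : ℕ} {d : Fin n → Type*}

section UnionEquiv

variable {X Y : Finset (Fin n)}

/-- The product basis of all shares, split into the shares in `X`, those in `Y` and the others. -/
def unionEquiv (d : Fin n → Type*) (h : Disjoint X Y) :
    (ShareIndex d X × ShareIndex d Y) × (∀ i : {i // i ∉ X ∪ Y}, d i) ≃ ∀ i, d i :=
  ((Equiv.piFinsetUnion d h).prodCongr (Equiv.refl _)).trans
    (Equiv.piEquivPiSubtypeProd (· ∈ X ∪ Y) d).symm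

variable (h : Disjoint X Y) (p : ShareIndex d X × ShareIndex d Y)
  (z : ∀ i : {i // i ∉ X ∪ Y}, d i) {i : Fin n}

lemma unionEquiv_apply_left (hi : i ∈ X) : unionEquiv d h (p, z) i = p.1 ⟨i, hi⟩ :=
  (dif_pos (Finset.mem_union_left Y hi)).trans (Equiv.piFinsetUnion_left d h hi _)

lemma unionEquiv_apply_right (hi : i ∈ Y) : unionEquiv d h (p, z) i = p.2 ⟨i, hi⟩ :=
  (dif_pos (Finset.mem_union_right X hi)).trans (Equiv.piFinsetUnion_right d h hi _)

lemma unionEquiv_apply_of_notMem (hi : i ∉ X ∪ Y) : unionEquiv d h (p, z) i = z ⟨i, hi⟩ :=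
  dif_neg hi

end UnionEquiv

variable [∀ i, Fintype (d i)]

lemma partialTrace_apply (X : Finset (Fin n)) (A : Matrix (∀ i, d i) (∀ i, d i) ℂ)
    (x x' : ShareIndex d X) :
    partialTrace d X A x x' = ∑ z, A ((Equiv.piEquivPiSubtypeProd (· ∈ X) d).symm (x, z))
      ((Equiv.piEquivPiSubtypeProd (· ∈ X) d).symm (x', z)) := rfl

lemma trace_partialTrace (X : Finset (Fin n)) (A : Matrix (∀ i, d i) (∀ i, d i) ℂ) :
    (partialTrace d X A).trace = A.trace := by
  rw [trace, trace, ← (Equiv.piEquivPiSubtypeProd (· ∈ X) d).symm.sum_comp, Fintype.sum_prod_type]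
  rfl

lemma partialTrace_mem_densityOperators (X : Finset (Fin n))
    {A : Matrix (∀ i, d i) (∀ i, d i) ℂ} (hA : A ∈ densityOperators (∀ i, d i)) :
    partialTrace d X A ∈ densityOperators (ShareIndex d X) := by
  let g := (Equiv.piEquivPiSubtypeProd (· ∈ X) d).symm
  have hsum : partialTrace d X A = ∑ z, A.submatrix (fun x => g (x, z)) (fun x => g (x, z)) := by
    ext x x'
    simp only [partialTrace_apply, Matrix.sum_apply, submatrix_apply, g]
  refine ⟨?_, (trace_partialTrace X A).trans hA.2⟩
  rw [hsum]
  exact posSemidef_sum _ fun z _ => hA.1.submatrix _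

lemma partialTrace_apply_of_equiv {c : Type*} [Fintype c] {X : Finset (Fin n)}
    (e : ShareIndex d X × c ≃ ∀ i, d i) (hX : ∀ x z (i : {i // i ∈ X}), e (x, z) i = x i)
    (hXc : ∀ x x' z, ∀ i ∉ X, e (x, z) i = e (x', z) i)
    (A : Matrix (∀ i, d i) (∀ i, d i) ℂ) (x x' : ShareIndex d X) :
    partialTrace d X A x x' = ∑ z, A (e (x, z)) (e (x', z)) := by
  let g := Equiv.piEquivPiSubtypeProd (· ∈ X) d
  let r (z : c) : ∀ i : {i // i ∉ X}, d i := fun i => e (x, z) i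
  have hglue (y : ShareIndex d X) (z : c) : g.symm (y, r z) = e (y, z) :=
    g.symm_apply_eq.mpr (Prod.ext (funext fun i => (hX y z i).symm)
      (funext fun i => hXc x y z i i.2))
  have hr : Function.Bijective r := by
    refine ⟨fun z z' hz => ?_, fun w => ?_⟩
    · have := (hglue x z).symm.trans ((congrArg (fun w => g.symm (x, w)) hz).trans (hglue x z'))
      exact (Prod.mk.inj (e.injective this)).2
    · obtain ⟨⟨y, z⟩, hz⟩ := e.surjective (g.symm (x, w))
      rw [← hglue, g.symm.injective.eq_iff] at hz
      exact ⟨z, (Prod.mk.inj hz).2⟩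
  rw [partialTrace_apply, ← hr.sum_comp]
  exact Finset.sum_congr rfl fun z _ => by rw [← hglue x z, ← hglue x' z]

variable {X Y : Finset (Fin n)} (h : Disjoint X Y)

lemma traceRight_partialTrace_union (A : Matrix (∀ i, d i) (∀ i, d i) ℂ) :
    traceRight ((partialTrace d (X ∪ Y) A).submatrix (Equiv.piFinsetUnion d h)
      (Equiv.piFinsetUnion d h)) = partialTrace d X A := by
  ext x x'
  rw [partialTrace_apply_of_equiv ((Equiv.prodAssoc _ _ _).symm.trans (unionEquiv d h))
    (fun x z i => unionEquiv_apply_left h (x, z.1) z.2 i.2) ?_, Fintype.sum_prod_type]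
  · rfl
  · intro x x' z i hi
    by_cases hY : i ∈ Y
    · exact (unionEquiv_apply_right h (x, z.1) z.2 hY).trans
        (unionEquiv_apply_right h (x', z.1) z.2 hY).symm
    · have hXY : i ∉ X ∪ Y := Finset.notMem_union.mpr ⟨hi, hY⟩
      exact (unionEquiv_apply_of_notMem h (x, z.1) z.2 hXY).trans
        (unionEquiv_apply_of_notMem h (x', z.1) z.2 hXY).symm

lemma traceLeft_partialTrace_union (A : Matrix (∀ i, d i) (∀ i, d i) ℂ) :
    traceLeft ((partialTrace d (X ∪ Y) A).submatrix (Equiv.piFinsetUnion d h)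
      (Equiv.piFinsetUnion d h)) = partialTrace d Y A := by
  ext y y'
  rw [partialTrace_apply_of_equiv ((Equiv.prodAssoc _ _ _).symm.trans
      (((Equiv.prodComm _ _).prodCongr (Equiv.refl _)).trans (unionEquiv d h)))
    (fun y z i => unionEquiv_apply_right h (z.1, y) z.2 i.2) ?_, Fintype.sum_prod_type]
  · rfl
  · intro y y' z i hi
    by_cases hX : i ∈ X
    · exact (unionEquiv_apply_left h (z.1, y) z.2 hX).trans
        (unionEquiv_apply_left h (z.1, y') z.2 hX).symm
    · have hXY : i ∉ X ∪ Y := Finset.notMem_union.mpr ⟨hX, hi⟩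
      exact (unionEquiv_apply_of_notMem h (z.1, y) z.2 hXY).trans
        (unionEquiv_apply_of_notMem h (z.1, y') z.2 hXY).symm

lemma submatrix_mem_densityOperators {b c : Type*} [Fintype b] [Fintype c]
    {ρ : Matrix b b ℂ} (hρ : ρ ∈ densityOperators b) (e : c ≃ b) :
    ρ.submatrix e e ∈ densityOperators c :=
  ⟨hρ.1.submatrix e, (e.sum_comp fun i => ρ i i).trans hρ.2⟩

lemma entropy_eq_zero_of_unique {c : Type*} [Fintype c] [DecidableEq c] [Unique c]
    {ρ : Matrix c c ℂ} (hρ : ρ ∈ densityOperators c) : entropy ρ = 0 := by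
  have hone : ρ = diagonal fun _ => ((1 : ℝ) : ℂ) := by
    ext i j
    have htr := hρ.2
    rw [trace, Fintype.sum_unique, diag_apply] at htr
    rw [Subsingleton.elim i default, Subsingleton.elim j default, htr, diagonal_apply_eq,
      Complex.ofReal_one]
  rw [hone, entropy_diagonal]
  simp only [negMulLog_one, Finset.sum_const_zero]

variable [∀ i, DecidableEq (d i)]

lemma entropy_partialTrace_union_le {A : Matrix (∀ i, d i) (∀ i, d i) ℂ}
    (hA : A ∈ densityOperators (∀ i, d i)) (h : Disjoint X Y) :
    entropy (partialTrace d (X ∪ Y) A) ≤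
      entropy (partialTrace d X A) + entropy (partialTrace d Y A) := by
  have hXY := partialTrace_mem_densityOperators (X ∪ Y) hA
  have hreindex := entropy_reindex (Equiv.piFinsetUnion d h).symm hXY.1.1
  have hle := entropy_le_add (submatrix_mem_densityOperators hXY (Equiv.piFinsetUnion d h))
  rw [traceRight_partialTrace_union, traceLeft_partialTrace_union] at hle
  exact hreindex.ge.trans hle

lemma entropy_partialTrace_le_sum {A : Matrix (∀ i, d i) (∀ i, d i) ℂ}
    (hA : A ∈ densityOperators (∀ i, d i)) (Y : Finset (Fin n)) :
    entropy (partialTrace d Y A) ≤ ∑ i ∈ Y, entropy (partialTrace d {i} A) := by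
  induction Y using Finset.induction_on with
  | empty => exact (entropy_eq_zero_of_unique (partialTrace_mem_densityOperators ∅ hA)).le
  | insert i Y hi ih =>
    rw [Finset.sum_insert hi, Finset.insert_eq]
    exact (entropy_partialTrace_union_le hA (Finset.disjoint_singleton_left.mpr hi)).trans
      (add_le_add_right ih _)

end Shares

section Secrets

variable {a : Type*} [Fintype a]

lemma Reversible.reindex {b c : Type*} [Fintype b] [Fintype c]
    {E : Matrix a a ℂ →ₗ[ℂ] Matrix b b ℂ} {S : Set (Matrix a a ℂ)} (hE : Reversible E S)
    (e : b ≃ c) : Reversible ((reindexLinearEquiv ℂ ℂ e e).toLinearMap ∘ₗ E) S := by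
  obtain ⟨R, hR, hRE⟩ := hE
  refine ⟨R ∘ₗ (reindexLinearEquiv ℂ ℂ e.symm e.symm).toLinearMap, ⟨fun m M hM => ?_, fun A => ?_⟩,
    fun ρ hρ => ?_⟩
  · exact hR.completelyPositive m _ (hM.submatrix (Prod.map id e))
  · exact (hR.tracePreserving _).trans (e.sum_comp fun i => A i i)
  · refine (congrArg R ?_).trans (hRE ρ hρ)
    exact (reindexLinearEquiv ℂ ℂ e e).symm_apply_apply (E ρ)

lemma reindexLinearEquiv_comp_krausMap {b c κ : Type*} [Fintype κ] (K : κ → Matrix b a ℂ)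
    (e : b ≃ c) : (reindexLinearEquiv ℂ ℂ e e).toLinearMap ∘ₗ krausMap K =
      krausMap fun z => (K z).submatrix e.symm id := by
  refine LinearMap.ext fun ρ => Matrix.ext fun i j => ?_
  rw [krausMap_apply_apply]
  exact krausMap_apply_apply K ρ _ _

variable {n : ℕ} {d : Fin n → Type*} [∀ i, Fintype (d i)]

lemma partialTrace_comp_krausMap {κ : Type*} [Fintype κ] (K : κ → Matrix (∀ i, d i) a ℂ)
    (X : Finset (Fin n)) :
    partialTrace d X ∘ₗ krausMap K = krausMap fun z : κ × (∀ i : {i // i ∉ X}, d i) =>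
      (K z.1).submatrix (fun x => (Equiv.piEquivPiSubtypeProd (· ∈ X) d).symm (x, z.2)) id := by
  refine LinearMap.ext fun ρ => Matrix.ext fun x x' => ?_
  rw [krausMap_apply_apply, Fintype.sum_prod_type_right]
  simp only [LinearMap.comp_apply, partialTrace_apply, krausMap_apply_apply]
  rfl

variable {W : Matrix a a ℂ →ₗ[ℂ] Matrix (∀ i, d i) (∀ i, d i) ℂ}

lemma IsScheme.qualified_univ (hW : IsScheme W) : Qualified W Finset.univ := by
  have : IsEmpty {i : Fin n // i ∉ Finset.univ} := ⟨fun i => i.2 (Finset.mem_univ _)⟩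
  let e := (Equiv.piEquivPiSubtypeProd (· ∈ Finset.univ) d).trans
    (Equiv.prodUnique (ShareIndex d Finset.univ) (∀ i : {i : Fin n // i ∉ Finset.univ}, d i))
  have he : marginal W Finset.univ = (reindexLinearEquiv ℂ ℂ e e).toLinearMap ∘ₗ W :=
    LinearMap.ext fun ρ => Matrix.ext fun x x' => Fintype.sum_unique _
  rw [Qualified, he]
  exact hW.reversible.reindex e

lemma IsScheme.forbidden_empty (hW : IsScheme W) : Forbidden W ∅ := by
  refine ⟨1, ⟨.one, by simp⟩, fun ρ hρ => ?_⟩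
  have htr : (marginal W ∅ ρ).trace = 1 :=
    (trace_partialTrace ∅ _).trans ((hW.isQuantumOperation.tracePreserving ρ).trans hρ.2)
  ext x y
  rw [trace, Fintype.sum_unique, diag_apply] at htr
  rw [Subsingleton.elim x default, Subsingleton.elim y default, htr, one_apply_eq]

variable {k L : ℕ}

lemma IsRampScheme.le_threshold (hW : IsRampScheme k L W) : L ≤ k := by
  have := (hW.forbidden_iff ∅).mp hW.forbidden_empty
  rw [Finset.card_empty] at this
  omega

lemma IsRampScheme.threshold_le (hW : IsRampScheme k L W) : k ≤ n := by
  simpa only [Finset.card_univ, Fintype.card_fin] using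
    (hW.qualified_iff Finset.univ).mp hW.qualified_univ

variable [DecidableEq a] [∀ i, DecidableEq (d i)] {X Y : Finset (Fin n)} {σ : Matrix a a ℂ}

theorem entropy_le_entropy_marginal (hW : IsQuantumOperation W) (h : Disjoint X Y)
    (hX : Forbidden W X) (hXY : Qualified W (X ∪ Y)) (hσ : σ ∈ densityOperators a) :
    entropy σ ≤ entropy (marginal W Y σ) := by
  obtain ⟨K, rfl⟩ := hW.exists_krausMap_eq
  let e := (Equiv.piFinsetUnion d h).symm
  have hM := (congrArg ((reindexLinearEquiv ℂ ℂ e e).toLinearMap ∘ₗ ·)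
    (partialTrace_comp_krausMap K (X ∪ Y))).trans (reindexLinearEquiv_comp_krausMap _ e)
  have hright : traceRight ∘ₗ (reindexLinearEquiv ℂ ℂ e e).toLinearMap ∘ₗ
      partialTrace d (X ∪ Y) ∘ₗ krausMap K = marginal (krausMap K) X :=
    LinearMap.ext fun ρ => traceRight_partialTrace_union h (krausMap K ρ)
  have hleft : traceLeft (((reindexLinearEquiv ℂ ℂ e e).toLinearMap ∘ₗ
      partialTrace d (X ∪ Y) ∘ₗ krausMap K) σ) = marginal (krausMap K) Y σ :=
    traceLeft_partialTrace_union h (krausMap K σ)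
  have hrev := hXY.reindex e
  rw [marginal, hM] at hrev
  rw [Forbidden, ← hright, hM] at hX
  rw [← hleft, hM]
  exact entropy_le_of_reversible_of_vanishing hrev hX hσ

end Secrets

section Averaging

variable {ι : Type*} [Fintype ι] {L : ℕ}

lemma sum_powersetCard_sum (hL : 1 ≤ L) (f : ι → ℝ) :
    ∑ s ∈ Finset.univ.powersetCard L, ∑ i ∈ s, f i =
      ((Fintype.card ι - 1).choose (L - 1) : ℝ) * ∑ i, f i := by
  classical
  have hcard (i : ι) : (((Finset.univ : Finset ι).powersetCard L).filter (i ∈ ·)).card =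
      (Fintype.card ι - 1).choose (L - 1) := by
    simpa using Finset.card_filter_powersetCard_subset {i} Finset.univ L
      (Finset.subset_univ _) (by simpa using hL)
  calc ∑ s ∈ Finset.univ.powersetCard L, ∑ i ∈ s, f i
      = ∑ i, ∑ _s ∈ (Finset.univ.powersetCard L).filter (i ∈ ·), f i :=
        Finset.sum_comm' fun _ _ => by simp
    _ = _ := by simp only [Finset.sum_const, hcard, nsmul_eq_mul, Finset.mul_sum]

theorem one_div_mul_le_one_div_card_mul_sum (hL : 1 ≤ L) (hLι : L ≤ Fintype.card ι) {c : ℝ}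
    {f : ι → ℝ} (h : ∀ s : Finset ι, s.card = L → c ≤ ∑ i ∈ s, f i) :
    1 / (L : ℝ) * c ≤ 1 / (Fintype.card ι : ℝ) * ∑ i, f i := by
  obtain ⟨l, rfl⟩ := Nat.exists_eq_add_of_le' hL
  obtain ⟨m, hm⟩ := Nat.exists_eq_add_of_le' (hL.trans hLι)
  have hpos : (0 : ℝ) < m.choose l := by exact_mod_cast Nat.choose_pos (by omega)
  have hchoose : ((m + 1 : ℕ) : ℝ) * m.choose l = (m + 1).choose (l + 1) * (l + 1 : ℕ) := by
    exact_mod_cast Nat.add_one_mul_choose_eq m l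
  have hsum : ((m + 1).choose (l + 1) : ℝ) * c ≤ m.choose l * ∑ i, f i := by
    have := Finset.card_nsmul_le_sum (Finset.univ.powersetCard (l + 1)) _ c
      fun _ hs => h _ (Finset.mem_powersetCard_univ.mp hs)
    rwa [sum_powersetCard_sum hL, Finset.card_powersetCard, Finset.card_univ, hm,
      nsmul_eq_mul] at this
  rw [hm, one_div_mul_eq_div, one_div_mul_eq_div, div_le_div_iff₀ (by positivity) (by positivity)]
  refine le_of_mul_le_mul_left ?_ hpos
  calc (m.choose l : ℝ) * (c * (m + 1 : ℕ)) = (m + 1).choose (l + 1) * c * (l + 1 : ℕ) := by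
        linear_combination c * hchoose
    _ ≤ m.choose l * (∑ i, f i) * (l + 1 : ℕ) := by gcongr
    _ = _ := mul_assoc _ _ _

end Averaging

end QSS

end

theorem theorem4_general {a : Type*} [Fintype a] [DecidableEq a] {n p L : ℕ} (hL : 1 ≤ L)
    (hpL : p + L ≤ n) {d : Fin n → Type*} [∀ i, Fintype (d i)] [∀ i, DecidableEq (d i)]
    {W : Matrix a a ℂ →ₗ[ℂ] Matrix (∀ i, d i) (∀ i, d i) ℂ} (hW : QSS.IsQuantumOperation W)
    (hforb : ∀ X : Finset (Fin n), X.card = p → QSS.Forbidden W X)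
    (hqual : ∀ X : Finset (Fin n), X.card = p + L → QSS.Qualified W X)
    {σ : Matrix a a ℂ} (hσ : σ ∈ QSS.densityOperators a) :
    1 / (L : ℝ) * QSS.entropy σ ≤
      1 / (n : ℝ) * ∑ i : Fin n, QSS.entropy (QSS.marginal W {i} σ) := by
  have hgroup (Y : Finset (Fin n)) (hY : Y.card = L) :
      QSS.entropy σ ≤ ∑ i ∈ Y, QSS.entropy (QSS.marginal W {i} σ) := by
    obtain ⟨X, hXY, hX⟩ := Finset.exists_subset_card_eq (s := Yᶜ) (n := p) (by
      rw [Finset.card_compl, Fintype.card_fin, hY]; omega)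
    have hdisj : Disjoint X Y := Finset.disjoint_left.mpr fun i hi =>
      Finset.mem_compl.mp (hXY hi)
    have hunion : (X ∪ Y).card = p + L := by rw [Finset.card_union_of_disjoint hdisj, hX, hY]
    exact (QSS.entropy_le_entropy_marginal hW hdisj (hforb X hX) (hqual _ hunion) hσ).trans
      (QSS.entropy_partialTrace_le_sum (hW.map_mem_densityOperators hσ) Y)
  simpa only [Fintype.card_fin] using QSS.one_div_mul_le_one_div_card_mul_sum hL
    (by rw [Fintype.card_fin]; omega) hgroup

theorem theorem4 {a : Type*} [Fintype a] [DecidableEq a] {n k L : ℕ} (hL : 1 ≤ L)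
    {d : Fin n → Type*} [∀ i, Fintype (d i)] [∀ i, DecidableEq (d i)]
    (W : Matrix a a ℂ →ₗ[ℂ] Matrix (∀ i, d i) (∀ i, d i) ℂ) (hW : QSS.IsRampScheme k L W)
    (μ : MeasureTheory.Measure (QSS.pureStates a)) [MeasureTheory.IsProbabilityMeasure μ]
    [μ.IsOpenPosMeasure] :
    1 / (L : ℝ) * QSS.entropy (QSS.averageState μ) ≤
      1 / (n : ℝ) * ∑ i : Fin n, QSS.entropy (QSS.marginal W {i} (QSS.averageState μ)) := by
  have hk : k - L + L = k := Nat.sub_add_cancel hW.le_threshold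
  exact theorem4_general hL (hk.trans_le hW.threshold_le) hW.isQuantumOperation
    (fun X hX => (hW.forbidden_iff X).mpr (by omega))
    (fun X hX => (hW.qualified_iff X).mpr (by omega)) (QSS.averageState_mem_densityOperators μ)
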